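/- A set $S$ of integers is called a Sidon set if the sums of two of its elements are distinct, that is, if $a+b=c+d$ with $a,b,c,d\in S$ implies $\{a,b\}=\{c,d\}$. For real $x$ let $S(x)=|S\cap[1,x]|$ denote the counting function of $S$. **Theorem (Ruzsa, 1998).** There exists an infinite Sidon set $S$ of positive integers whose counting function satisfies $S(x)=x^{\sqrt2-1+o(1)}$ as $x\to\infty$; that is, there is a function $\varepsilon:\mathbb R\to\mathbb R$ with $\varepsilon(x)\to0$ as $x\to\infty$ such that $S(x)=x^{\sqrt2-1+\varepsilon(x)}$ for all sufficiently large real $x$. -/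

import Mathlib

open Filter Topology

/-- A set of integers is a Sidon set if the sums `a + b` of two (not necessarily different)
elements are distinct, apart from the trivial coincidence `a + b = b + a`. -/
def IsSidonSet (S : Set ℤ) : Prop :=
  ∀ a ∈ S, ∀ b ∈ S, ∀ c ∈ S, ∀ d ∈ S,
    a + b = c + d → (a = c ∧ b = d) ∨ (a = d ∧ b = c)

/-- The counting function of a set of integers: the cardinality of `S ∩ [1, x]`, for real `x`.
The set is always finite. -/
noncomputable def countingFunction (S : Set ℤ) (x : ℝ) : ℕ :=
  Set.ncard {n : ℤ | n ∈ S ∧ 1 ≤ n ∧ (n : ℝ) ≤ x}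

/-! ### Mixed radix expansions -/

/-! Ruzsa's idea is that the logarithms of primes form a Sidon set by unique factorization. Real
logarithms are replaced by discrete ones: a prime `p` of level `K` is coded by its discrete
logarithms modulo primes `q_j ≈ 4^j`, `j < K`, written as mixed radix digits in bases `4 q_j`. Each
logarithm lies in `(q_j, 2 q_j)`, so adding two codes never carries, and the size of each digit sum
shows whether two, one or no codes contribute there. A sum of codes of levels `L ≤ K` therefore
determines `K`, `L`, the product of the two primes modulo `Q = ∏_{j<L} q_j`, and the prime of level
`K` modulo `R = ∏_{L≤j<K} q_j` (`levels_eq_of_code_add_eq`, `dvd_of_code_add_eq`).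

Let `c = √2 - 1` and let level `K` consist of primes up to `2^{n_K}`, `n_K ≈ c K² - K`. Since
`∏_{j<K} q_j ≥ 2^{K²}`, for `L = K` the congruence between products is an equality and unique
factorization finishes. For `L < K` it may be a proper congruence: `ps - rt = uQ`, `p - r = vR`.
Such `p` are discarded. They are rare: `p` divides `uQ - vtR = p(s - t) ≠ 0`, so each triple `(t, u,
v)` accounts for at most `K²` primes, and there are about `2^{2n_K + 2n_L - K²}` triples. This is at
most about `2^{n_K - K}` because `u ≠ 0` forces `L² ≤ n_K + n_L`; the optimal `c` solves `c² + 2c =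
1` (`levelExp_add_le`).

Codes of level `K` have size `2^{K² + O(K)}`, and for large `K` at least `2^{n_K - K}` primes
survive by Chebyshev's bound. With `K ≈ √(log₂ x)` this gives `S(x) = 2^{c log₂ x + O(√(log₂ x))}`.
-/

theorem sum_mixedRadix_lt {b d : ℕ → ℕ} (N : ℕ) (h : ∀ j < N, d j < b j) :
    ∑ j ∈ Finset.range N, d j * ∏ i ∈ Finset.range j, b i < ∏ i ∈ Finset.range N, b i := by
  induction N with
  | zero => simp
  | succ N ih =>
    rw [Finset.sum_range_succ, Finset.prod_range_succ]
    have h1 := ih fun j hj => h j (hj.trans N.lt_succ_self)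
    have h2 : (d N + 1) * ∏ i ∈ Finset.range N, b i ≤ b N * ∏ i ∈ Finset.range N, b i :=
      Nat.mul_le_mul_right _ (h N N.lt_succ_self)
    linarith

theorem mixedRadix_injective {b d e : ℕ → ℕ} (N : ℕ) (hd : ∀ j < N, d j < b j)
    (he : ∀ j < N, e j < b j)
    (h : ∑ j ∈ Finset.range N, d j * ∏ i ∈ Finset.range j, b i =
      ∑ j ∈ Finset.range N, e j * ∏ i ∈ Finset.range j, b i) :
    ∀ j < N, d j = e j := by
  induction N with
  | zero => simp
  | succ N ih =>
    have hd' : ∀ j < N, d j < b j := fun j hj => hd j (hj.trans N.lt_succ_self)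
    have he' : ∀ j < N, e j < b j := fun j hj => he j (hj.trans N.lt_succ_self)
    have h1 := sum_mixedRadix_lt N hd'
    have h2 := sum_mixedRadix_lt N he'
    rw [Finset.sum_range_succ, Finset.sum_range_succ] at h
    have hN : d N = e N := by
      rcases lt_trichotomy (d N) (e N) with hlt | heq | hlt
      · have := Nat.mul_le_mul_right (∏ i ∈ Finset.range N, b i) (Nat.succ_le_of_lt hlt)
        rw [Nat.succ_mul] at this
        omega
      · exact heq
      · have := Nat.mul_le_mul_right (∏ i ∈ Finset.range N, b i) (Nat.succ_le_of_lt hlt)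
        rw [Nat.succ_mul] at this
        omega
    rw [hN] at h
    intro j hj
    rcases Nat.lt_succ_iff_lt_or_eq.1 hj with hj | rfl
    · exact ih hd' he' (Nat.add_right_cancel h) j hj
    · exact hN

/-! ### Prime moduli and discrete logarithms -/

theorem exists_prime_between_two_pow (j : ℕ) :
    ∃ q : ℕ, q.Prime ∧ 2 ^ (2 * j + 1) < q ∧ q ≤ 2 ^ (2 * j + 2) := by
  obtain ⟨q, hq, h1, h2⟩ := Nat.exists_prime_lt_and_le_two_mul (2 ^ (2 * j + 1)) (by positivity)
  exact ⟨q, hq, h1, h2.trans_eq (by ring)⟩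

/-- A prime in the dyadic interval `(2 ^ (2 * j + 1), 2 ^ (2 * j + 2)]`. -/
noncomputable def modulus (j : ℕ) : ℕ := (exists_prime_between_two_pow j).choose

theorem modulus_prime (j : ℕ) : (modulus j).Prime := (exists_prime_between_two_pow j).choose_spec.1

theorem lt_modulus (j : ℕ) : 2 ^ (2 * j + 1) < modulus j :=
  (exists_prime_between_two_pow j).choose_spec.2.1

theorem modulus_le (j : ℕ) : modulus j ≤ 2 ^ (2 * j + 2) :=
  (exists_prime_between_two_pow j).choose_spec.2.2

theorem modulus_strictMono : StrictMono modulus := by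
  refine strictMono_nat_of_lt_succ fun j => (modulus_le j).trans_lt (lt_trans ?_ (lt_modulus (j + 1)))
  exact Nat.pow_lt_pow_right (by norm_num) (by omega)

theorem coprime_modulus {i j : ℕ} (h : i ≠ j) : (modulus i).Coprime (modulus j) :=
  (Nat.coprime_primes (modulus_prime i) (modulus_prime j)).2 (modulus_strictMono.injective.ne h)

/-- The open window `(q, 2q)` contains `q - 1` consecutive integers, hence one representative of
each exponent modulo `q - 1`. A strictly positive lower end is what later separates one digit from
the sum of two. -/
theorem exists_discreteLog (q : ℕ) (hq : q.Prime) :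
    ∃ (g : ZMod q) (f : ℕ → ℕ), ∀ m, q < f m ∧ f m < 2 * q ∧ (¬ q ∣ m → g ^ f m = m) := by
  have : Fact q.Prime := ⟨hq⟩
  obtain ⟨g, hg⟩ := IsCyclic.exists_monoid_generator (α := (ZMod q)ˣ)
  have key : ∀ m : ℕ, ∃ k, q < k ∧ k < 2 * q ∧ (¬ q ∣ m → (g : ZMod q) ^ k = m) := by
    intro m
    by_cases hm : q ∣ m
    -- A multiple of `q` has no logarithm; `q + 1` only keeps the bounds valid.
    · exact ⟨q + 1, by omega, by have := hq.two_le; omega, fun h => absurd hm h⟩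
    · have hu : (m : ZMod q) ≠ 0 := by rwa [Ne, ZMod.natCast_eq_zero_iff]
      -- Dividing by `g ^ (q + 1)` first lets the exponent be reduced modulo `q - 1` and then
      -- shifted into the window.
      obtain ⟨k, hk⟩ := Submonoid.mem_powers_iff _ _ |>.1 (hg (Units.mk0 (m : ZMod q) hu * (g ^ (q + 1))⁻¹))
      have ho : orderOf g ∣ q - 1 := by
        rw [← ZMod.card_units q]; exact orderOf_dvd_card
      have hq1 : 0 < q - 1 := by have := hq.two_le; omega
      have hmod : k % (q - 1) < q - 1 := Nat.mod_lt _ hq1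
      refine ⟨k % (q - 1) + (q + 1), by omega, by omega, fun _ => ?_⟩
      have h1 : g ^ (k % (q - 1)) = g ^ k := by
        conv_rhs => rw [← Nat.mod_add_div k (q - 1), pow_add, pow_mul,
          orderOf_dvd_iff_pow_eq_one.1 ho, one_pow, mul_one]
      have h2 : g ^ (k % (q - 1) + (q + 1)) = Units.mk0 (m : ZMod q) hu := by
        rw [pow_add, h1, hk, inv_mul_cancel_right]
      simpa using congrArg (Units.val) h2
  choose f hf using key
  exact ⟨g, f, hf⟩

/-- A discrete logarithm of `m` modulo `modulus j`, normalized to lie strictly between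
`modulus j` and `2 * modulus j`. -/
noncomputable def discreteLog (j : ℕ) : ℕ → ℕ :=
  (exists_discreteLog (modulus j) (modulus_prime j)).choose_spec.choose

theorem modulus_lt_discreteLog (j m : ℕ) : modulus j < discreteLog j m :=
  ((exists_discreteLog (modulus j) (modulus_prime j)).choose_spec.choose_spec m).1

theorem discreteLog_lt (j m : ℕ) : discreteLog j m < 2 * modulus j :=
  ((exists_discreteLog (modulus j) (modulus_prime j)).choose_spec.choose_spec m).2.1

theorem exists_pow_discreteLog (j : ℕ) :
    ∃ g : ZMod (modulus j), ∀ m, ¬ modulus j ∣ m → g ^ discreteLog j m = m :=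
  ⟨_, fun m => ((exists_discreteLog (modulus j) (modulus_prime j)).choose_spec.choose_spec m).2.2⟩

theorem modulus_dvd_sub {j a c : ℕ} (ha : ¬ modulus j ∣ a) (hc : ¬ modulus j ∣ c)
    (h : discreteLog j a = discreteLog j c) : (modulus j : ℤ) ∣ a - c := by
  obtain ⟨g, hg⟩ := exists_pow_discreteLog j
  rw [← ZMod.intCast_zmod_eq_zero_iff_dvd]
  push_cast
  rw [← hg a ha, ← hg c hc, h, sub_self]

theorem modulus_dvd_mul_sub_mul {j a b c d : ℕ} (ha : ¬ modulus j ∣ a) (hb : ¬ modulus j ∣ b)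
    (hc : ¬ modulus j ∣ c) (hd : ¬ modulus j ∣ d)
    (h : discreteLog j a + discreteLog j b = discreteLog j c + discreteLog j d) :
    (modulus j : ℤ) ∣ a * b - c * d := by
  obtain ⟨g, hg⟩ := exists_pow_discreteLog j
  rw [← ZMod.intCast_zmod_eq_zero_iff_dvd]
  push_cast
  rw [← hg a ha, ← hg b hb, ← hg c hc, ← hg d hd, ← pow_add, ← pow_add, h, sub_self]

/-! ### The encoding -/

/-- The number whose mixed radix digits in the bases `4 * modulus j`, `j < K`, are the discrete
logarithms of `p`. -/
noncomputable def code (K p : ℕ) : ℕ :=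
  ∑ j ∈ Finset.range K, discreteLog j p * ∏ i ∈ Finset.range j, 4 * modulus i

theorem code_eq_sum {K N : ℕ} (h : K ≤ N) (p : ℕ) :
    code K p = ∑ j ∈ Finset.range N,
      (if j < K then discreteLog j p else 0) * ∏ i ∈ Finset.range j, 4 * modulus i := by
  rw [code, ← Finset.sum_subset (Finset.range_mono h)]
  · exact Finset.sum_congr rfl fun j hj => by rw [if_pos (Finset.mem_range.1 hj)]
  · intro j _ hj
    rw [if_neg (by simpa using hj), zero_mul]

theorem code_lt (K p : ℕ) : code K p < ∏ i ∈ Finset.range K, 4 * modulus i :=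
  sum_mixedRadix_lt K fun j _ => by have := discreteLog_lt j p; omega

/-- Two digits below `2 q_j` add up to less than the base `4 q_j`, so there are no carries and equal
sums have equal digit sums. -/
theorem digit_eq_of_code_add_eq {K L K' L' a b c d : ℕ}
    (h : code K a + code L b = code K' c + code L' d) (j : ℕ) :
    (if j < K then discreteLog j a else 0) + (if j < L then discreteLog j b else 0) =
      (if j < K' then discreteLog j c else 0) + (if j < L' then discreteLog j d else 0) := by
  set N := max (max K L) (max (max K' L') (j + 1))
  rw [code_eq_sum (N := N) (by omega), code_eq_sum (N := N) (by omega),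
    code_eq_sum (N := N) (by omega), code_eq_sum (N := N) (by omega),
    ← Finset.sum_add_distrib, ← Finset.sum_add_distrib] at h
  simp only [← add_mul] at h
  have hlt : ∀ (A B u v i : ℕ), (if i < A then discreteLog i u else 0) +
      (if i < B then discreteLog i v else 0) < 4 * modulus i := by
    intro A B u v i
    have := discreteLog_lt i u
    have := discreteLog_lt i v
    split_ifs <;> omega
  exact mixedRadix_injective (b := fun i => 4 * modulus i) N (fun i _ => hlt K L a b i)
    (fun i _ => hlt K' L' c d i) h j (by omega)

/-- The digit sum at `j` lies in `(2 q_j, 4 q_j)` for `j < L`, in `(q_j, 2 q_j)` for `L ≤ j < K`,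
and is `0` beyond. These ranges are disjoint, so both levels can be read off. -/
theorem levels_eq_of_code_add_eq {K L K' L' a b c d : ℕ} (hL : L ≤ K) (hL' : L' ≤ K')
    (h : code K a + code L b = code K' c + code L' d) : K = K' ∧ L = L' := by
  have key := digit_eq_of_code_add_eq h
  have h1 := fun j => modulus_lt_discreteLog j a
  have h2 := fun j => modulus_lt_discreteLog j b
  have h3 := fun j => modulus_lt_discreteLog j c
  have h4 := fun j => modulus_lt_discreteLog j d
  have h1' := fun j => discreteLog_lt j a
  have h3' := fun j => discreteLog_lt j c
  have hK : K = K' := by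
    rcases lt_trichotomy K K' with hlt | heq | hlt
    · have := key K; have := h3 K
      grind
    · exact heq
    · have := key K'; have := h1 K'
      grind
  refine ⟨hK, ?_⟩
  subst hK
  rcases lt_trichotomy L L' with hlt | heq | hlt
  · have := key L; have := h3 L; have := h4 L; have := h1' L
    grind
  · exact heq
  · have := key L'; have := h1 L'; have := h2 L'; have := h3' L'
    grind

theorem prod_modulus_dvd {s : Finset ℕ} {z : ℤ} (h : ∀ j ∈ s, (modulus j : ℤ) ∣ z) :
    ((∏ j ∈ s, modulus j : ℕ) : ℤ) ∣ z := by
  push_cast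
  refine Finset.prod_dvd_of_coprime (fun i _ j _ hij => ?_) h
  exact Nat.isCoprime_iff_coprime.2 (coprime_modulus hij)

theorem dvd_of_code_add_eq {K L a b c d : ℕ} (hL : L ≤ K)
    (ha : ∀ j < K, ¬ modulus j ∣ a) (hb : ∀ j < L, ¬ modulus j ∣ b)
    (hc : ∀ j < K, ¬ modulus j ∣ c) (hd : ∀ j < L, ¬ modulus j ∣ d)
    (h : code K a + code L b = code K c + code L d) :
    ((∏ j ∈ Finset.range L, modulus j : ℕ) : ℤ) ∣ a * b - c * d ∧
      ((∏ j ∈ Finset.Ico L K, modulus j : ℕ) : ℤ) ∣ a - c := by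
  have key := digit_eq_of_code_add_eq h
  constructor
  · refine prod_modulus_dvd fun j hj => ?_
    have hjL := Finset.mem_range.1 hj
    have := key j
    simp only [hjL, hjL.trans_le hL, if_true] at this
    exact modulus_dvd_mul_sub_mul (ha j (hjL.trans_le hL)) (hb j hjL) (hc j (hjL.trans_le hL))
      (hd j hjL) this
  · refine prod_modulus_dvd fun j hj => ?_
    obtain ⟨h1, h2⟩ := Finset.mem_Ico.1 hj
    have := key j
    simp only [h2, not_lt.2 h1, if_true, if_false, add_zero] at this
    exact modulus_dvd_sub (ha j h2) (hc j h2) this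

/-! ### Size estimates -/

/-- The odd exponents `2j + 1`, `j < K`, add up to `K²`. -/
theorem two_pow_sq_le_prod_modulus (K : ℕ) : 2 ^ K ^ 2 ≤ ∏ j ∈ Finset.range K, modulus j := by
  induction K with
  | zero => simp
  | succ K ih =>
    rw [Finset.prod_range_succ, show (K + 1) ^ 2 = K ^ 2 + (2 * K + 1) by ring, pow_add]
    exact Nat.mul_le_mul ih (lt_modulus K).le

theorem prod_modulus_le (K : ℕ) : ∏ j ∈ Finset.range K, modulus j ≤ 2 ^ (K ^ 2 + K) := by
  induction K with
  | zero => simp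
  | succ K ih =>
    rw [Finset.prod_range_succ,
      show (K + 1) ^ 2 + (K + 1) = (K ^ 2 + K) + (2 * K + 2) by ring, pow_add]
    exact Nat.mul_le_mul ih (modulus_le K)

/-- This says `R ≥ 2^{K² - L²}`, multiplied out to avoid subtraction in the exponent. -/
theorem two_pow_le_prod_Ico_modulus {L K : ℕ} (h : L ≤ K) :
    2 ^ K ^ 2 ≤ 2 ^ L ^ 2 * ∏ j ∈ Finset.Ico L K, modulus j := by
  induction K, h using Nat.le_induction with
  | base => simp
  | succ K hK ih =>
    rw [Finset.prod_Ico_succ_top hK, show (K + 1) ^ 2 = K ^ 2 + (2 * K + 1) by ring, pow_add,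
      ← mul_assoc]
    exact Nat.mul_le_mul ih (lt_modulus K).le

theorem code_lt_two_pow (K p : ℕ) : code K p < 2 ^ (K + 2) ^ 2 := by
  refine (code_lt K p).trans_le ?_
  rw [Finset.prod_mul_distrib, Finset.prod_const, Finset.card_range]
  refine (Nat.mul_le_mul_left _ (prod_modulus_le K)).trans ?_
  rw [show 4 = 2 ^ 2 by norm_num, ← pow_mul, ← pow_add]
  exact Nat.pow_le_pow_right (by norm_num) (by nlinarith)

theorem two_pow_le_code {K : ℕ} (hK : 0 < K) (p : ℕ) : 2 ^ K ^ 2 ≤ code K p := by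
  obtain ⟨k, rfl⟩ : ∃ k, K = k + 1 := ⟨K - 1, by omega⟩
  rw [code, Finset.sum_range_succ]
  refine le_trans ?_ (Nat.le_add_left _ _)
  rw [Finset.prod_mul_distrib, show (k + 1) ^ 2 = (2 * k + 1) + k ^ 2 by ring, pow_add]
  refine Nat.mul_le_mul ((lt_modulus k).trans (modulus_lt_discreteLog k p)).le ?_
  refine (two_pow_sq_le_prod_modulus k).trans (Nat.le_mul_of_pos_left _ ?_)
  exact Finset.prod_pos fun _ _ => by norm_num

/-! ### Levels of primes -/

theorem sqrt_two_sub_one_mem : 0.4142 < √2 - 1 ∧ √2 - 1 < 0.4143 := by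
  constructor
  · rw [lt_sub_iff_add_lt]; exact Real.lt_sqrt_of_sq_lt (by norm_num)
  · rw [sub_lt_iff_lt_add, Real.sqrt_lt' (by norm_num)]; norm_num

theorem sqrt_two_sub_one_sq : (√2 - 1) ^ 2 + 2 * (√2 - 1) = 1 := by
  have := Real.sq_sqrt (show (0 : ℝ) ≤ 2 by norm_num)
  linear_combination this

/-- The primes of level `K` are at most `2 ^ levelExp K`. -/
noncomputable def levelExp (K : ℕ) : ℕ := ⌊(√2 - 1) * K ^ 2 - K⌋₊

theorem levelExp_of_le_two {K : ℕ} (hK : K ≤ 2) : levelExp K = 0 := by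
  have h := sqrt_two_sub_one_mem.2
  refine Nat.floor_eq_zero.2 ?_
  have : (K : ℝ) ≤ 2 := by exact_mod_cast hK
  have : (0 : ℝ) ≤ K := K.cast_nonneg
  nlinarith [mul_nonneg (sq_nonneg (K : ℝ)) (sub_nonneg.2 h.le)]

/-- The hypothesis is needed: at `K = 1` and `K = 2` the quantity under the floor is negative and
gets truncated to `0`. -/
theorem levelExp_le {K : ℕ} (h : levelExp K ≠ 0) :
    (levelExp K : ℝ) ≤ (√2 - 1) * K ^ 2 - K :=
  Nat.floor_le (Nat.pos_of_floor_pos (Nat.pos_of_ne_zero h)).le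

theorem lt_levelExp_add_one (K : ℕ) : (√2 - 1) * K ^ 2 - K < levelExp K + 1 :=
  Nat.lt_floor_add_one _

theorem levelExp_mono : Monotone levelExp := by
  refine monotone_nat_of_le_succ fun K => ?_
  rcases le_or_gt K 2 with hK | hK
  · rw [levelExp_of_le_two hK]; exact Nat.zero_le _
  · refine Nat.floor_mono ?_
    have : (3 : ℝ) ≤ K := by exact_mod_cast hK
    have := sqrt_two_sub_one_mem.1
    push_cast
    nlinarith

theorem two_mul_levelExp_le (K : ℕ) : 2 * levelExp K ≤ K ^ 2 := by
  by_cases h : levelExp K = 0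
  · simp [h]
  have h1 := levelExp_le h
  have := sqrt_two_sub_one_mem.2
  have : (0 : ℝ) ≤ K := K.cast_nonneg
  have : (2 * levelExp K : ℝ) ≤ K ^ 2 := by nlinarith [sq_nonneg (K : ℝ)]
  exact_mod_cast this

/-- The inequality that determines the exponent `√2 - 1`. -/
theorem levelExp_add_le {K L : ℕ} (hL0 : levelExp L ≠ 0) (hLK : L ≤ K)
    (h : L ^ 2 ≤ levelExp K + levelExp L) :
    levelExp K + 2 * levelExp L + K ≤ K ^ 2 := by
  have hK0 : levelExp K ≠ 0 := fun h0 => hL0 (Nat.le_zero.1 (h0 ▸ levelExp_mono hLK))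
  have hK := levelExp_le hK0
  have hL := levelExp_le hL0
  obtain ⟨c1, c2⟩ := sqrt_two_sub_one_mem
  have hc := sqrt_two_sub_one_sq
  set c := √2 - 1
  have h' : (L : ℝ) ^ 2 ≤ levelExp K + levelExp L := by exact_mod_cast h
  have k0 : (0 : ℝ) ≤ K := K.cast_nonneg
  have l0 : (0 : ℝ) ≤ L := L.cast_nonneg
  have h1 : (1 - c) * (L : ℝ) ^ 2 ≤ c * K ^ 2 - K := by linarith
  have h2 : (1 - c) * (c * K ^ 2 + 2 * (c * L ^ 2)) ≤ (1 - c) * K ^ 2 - 2 * c * K := by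
    have := mul_le_mul_of_nonneg_left h1 (show (0 : ℝ) ≤ 2 * c by linarith)
    -- The coefficients match exactly because `c² + 2c = 1`.
    have e : (c * (1 - c) + 2 * c ^ 2) * (K : ℝ) ^ 2 = (1 - c) * K ^ 2 := by
      congr 1; linear_combination hc
    linarith
  have h3 : c * (K : ℝ) ^ 2 + 2 * (c * L ^ 2) ≤ K ^ 2 := by
    refine le_of_mul_le_mul_left (h2.trans ?_) (show (0 : ℝ) < 1 - c by linarith)
    have : 0 ≤ c * (K : ℝ) := mul_nonneg (by linarith) k0
    linarith
  -- The `- K` in the definition of `levelExp K` pays for the `+ K` on the left.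
  have : (levelExp K + 2 * levelExp L + K : ℝ) ≤ K ^ 2 := by linarith
  exact_mod_cast this

/-- The primes of level `K`. -/
noncomputable def levelPrimes (K : ℕ) : Finset ℕ :=
  (Finset.Ioc (max (2 ^ levelExp (K - 1)) (2 ^ (2 * K))) (2 ^ levelExp K)).filter Nat.Prime

theorem mem_levelPrimes {K p : ℕ} : p ∈ levelPrimes K ↔
    (2 ^ levelExp (K - 1) < p ∧ 2 ^ (2 * K) < p) ∧ p ≤ 2 ^ levelExp K ∧ p.Prime := by
  simp [levelPrimes, and_assoc]

theorem prime_of_mem_levelPrimes {K p : ℕ} (h : p ∈ levelPrimes K) : p.Prime :=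
  (mem_levelPrimes.1 h).2.2

theorem le_of_mem_levelPrimes {K p : ℕ} (h : p ∈ levelPrimes K) : p ≤ 2 ^ levelExp K :=
  (mem_levelPrimes.1 h).2.1

theorem levelExp_ne_zero_of_mem {K p : ℕ} (h : p ∈ levelPrimes K) : levelExp K ≠ 0 := by
  intro h0
  have := le_of_mem_levelPrimes h
  rw [h0, pow_zero] at this
  exact absurd this (not_le.2 (prime_of_mem_levelPrimes h).one_lt)

theorem pos_of_mem_levelPrimes {K p : ℕ} (h : p ∈ levelPrimes K) : 0 < K := by
  rcases Nat.eq_zero_or_pos K with rfl | hK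
  · exact absurd (levelExp_of_le_two (by norm_num)) (levelExp_ne_zero_of_mem h)
  · exact hK

/-- This is the purpose of the cutoff `2 ^ (2 * K)` in `levelPrimes`: it exceeds or equals every
modulus in use, so `p` is a different prime and its logarithms are genuine. -/
theorem not_modulus_dvd {K p j : ℕ} (h : p ∈ levelPrimes K) (hj : j < K) : ¬ modulus j ∣ p := by
  intro hd
  have h1 := (Nat.prime_dvd_prime_iff_eq (modulus_prime j) (prime_of_mem_levelPrimes h)).1 hd
  have h2 := modulus_le j
  have h3 : 2 ^ (2 * j + 2) ≤ 2 ^ (2 * K) := Nat.pow_le_pow_right (by norm_num) (by omega)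
  have h4 := (mem_levelPrimes.1 h).1.2
  omega

theorem ne_of_mem_levelPrimes {K L p r : ℕ} (hLK : L < K) (hp : p ∈ levelPrimes K)
    (hr : r ∈ levelPrimes L) : p ≠ r := by
  have h1 := (mem_levelPrimes.1 hp).1.1
  have h2 := le_of_mem_levelPrimes hr
  have h3 : 2 ^ levelExp L ≤ 2 ^ levelExp (K - 1) :=
    Nat.pow_le_pow_right (by norm_num) (levelExp_mono (by omega))
  omega

theorem abs_sub_lt_of_mem_levelPrimes {K p r : ℕ} (hp : p ∈ levelPrimes K)
    (hr : r ∈ levelPrimes K) : |(p : ℤ) - r| < 2 ^ levelExp K := by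
  have h1 : (p : ℤ) ≤ 2 ^ levelExp K := by exact_mod_cast le_of_mem_levelPrimes hp
  have h2 : (r : ℤ) ≤ 2 ^ levelExp K := by exact_mod_cast le_of_mem_levelPrimes hr
  have h3 := (prime_of_mem_levelPrimes hp).pos
  have h4 := (prime_of_mem_levelPrimes hr).pos
  rw [abs_lt]; omega

theorem isCoprime_prod_modulus {K L p : ℕ} (h : p ∈ levelPrimes K) (hL : L ≤ K) :
    IsCoprime ((∏ j ∈ Finset.range L, modulus j : ℕ) : ℤ) (p : ℤ) := by
  rw [Nat.isCoprime_iff_coprime]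
  refine Nat.Coprime.prod_left fun j hj => ?_
  exact (modulus_prime j).coprime_iff_not_dvd.2
    (not_modulus_dvd h ((Finset.mem_range.1 hj).trans_le hL))

theorem eq_of_prod_modulus_dvd_sub {K p r : ℕ} (hp : p ∈ levelPrimes K) (hr : r ∈ levelPrimes K)
    (h : ((∏ j ∈ Finset.range K, modulus j : ℕ) : ℤ) ∣ (p : ℤ) - r) : p = r := by
  have h1 : ((2 ^ K ^ 2 : ℕ) : ℤ) ≤ (∏ j ∈ Finset.range K, modulus j : ℕ) := by
    exact_mod_cast two_pow_sq_le_prod_modulus K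
  have h2 : ((2 ^ levelExp K : ℕ) : ℤ) ≤ (2 ^ K ^ 2 : ℕ) := by
    exact_mod_cast Nat.pow_le_pow_right (by norm_num) (by have := two_mul_levelExp_le K; omega)
  have h3 := abs_sub_lt_of_mem_levelPrimes hp hr
  have := Int.eq_zero_of_abs_lt_dvd h (lt_of_lt_of_le h3 (by push_cast at *; linarith))
  omega

/-- The primes of level `K` that may occur, at the top level, in a coincidence between sums of
codes of primes from two different levels. -/
def IsColliding (K p : ℕ) : Prop :=
  ∃ L < K, ∃ r ∈ levelPrimes K, ∃ s ∈ levelPrimes L, ∃ t ∈ levelPrimes L, p ≠ r ∧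
    ((∏ j ∈ Finset.range L, modulus j : ℕ) : ℤ) ∣ p * s - r * t ∧
    ((∏ j ∈ Finset.Ico L K, modulus j : ℕ) : ℤ) ∣ (p : ℤ) - r

/-! ### Coincidences within one level and between two levels -/

theorem eq_or_swap_of_mul_eq {a b c d : ℕ} (ha : a.Prime) (hc : c.Prime) (hd : d.Prime)
    (h : a * b = c * d) : (a = c ∧ b = d) ∨ (a = d ∧ b = c) := by
  rcases (ha.dvd_mul).1 (h ▸ dvd_mul_right a b) with h1 | h1
  · obtain rfl := (Nat.prime_dvd_prime_iff_eq ha hc).1 h1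
    exact Or.inl ⟨rfl, Nat.eq_of_mul_eq_mul_left ha.pos h⟩
  · obtain rfl := (Nat.prime_dvd_prime_iff_eq ha hd).1 h1
    exact Or.inr ⟨rfl, Nat.eq_of_mul_eq_mul_left ha.pos (h.trans (mul_comm _ _))⟩

/-- The products `ab` and `cd` are congruent modulo `∏_{j<K} q_j` and both lie in `(0, ∏_{j<K}
q_j]`, since `2 n_K ≤ K²`. Hence they are equal, and unique factorization applies. -/
theorem eq_or_swap_of_code_add_eq_same_level {K a b c d : ℕ} (ha : a ∈ levelPrimes K)
    (hb : b ∈ levelPrimes K) (hc : c ∈ levelPrimes K) (hd : d ∈ levelPrimes K)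
    (h : code K a + code K b = code K c + code K d) : (a = c ∧ b = d) ∨ (a = d ∧ b = c) := by
  have h1 := (dvd_of_code_add_eq le_rfl (fun _ => not_modulus_dvd ha) (fun _ => not_modulus_dvd hb)
    (fun _ => not_modulus_dvd hc) (fun _ => not_modulus_dvd hd) h).1
  refine eq_or_swap_of_mul_eq (prime_of_mem_levelPrimes ha) (prime_of_mem_levelPrimes hc)
    (prime_of_mem_levelPrimes hd) ?_
  have hle : ∀ {u v : ℕ}, u ∈ levelPrimes K → v ∈ levelPrimes K →
      0 < u * v ∧ u * v ≤ ∏ j ∈ Finset.range K, modulus j := fun {u v} hu hv =>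
    ⟨Nat.mul_pos (prime_of_mem_levelPrimes hu).pos (prime_of_mem_levelPrimes hv).pos, by
      refine (Nat.mul_le_mul (le_of_mem_levelPrimes hu) (le_of_mem_levelPrimes hv)).trans ?_
      rw [← pow_add]
      refine le_trans ?_ (two_pow_sq_le_prod_modulus K)
      exact Nat.pow_le_pow_right (by norm_num) (by have := two_mul_levelExp_le K; omega)⟩
  have h2 := hle ha hb
  have h3 := hle hc hd
  have := Int.eq_zero_of_abs_lt_dvd h1 (by
    generalize ∏ j ∈ Finset.range K, modulus j = Q at h2 h3 ⊢
    rw [abs_lt]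
    zify at h2 h3
    constructor <;> linarith)
  zify
  linarith

/-- If `a ≠ c`, the coincidence is exactly a collision witness for `a`. If `a = c`, then `a` is
coprime to the moduli and cancels from `a(b - d)`, and `b = d` by size. -/
theorem eq_of_code_add_eq_of_lt {K L a b c d : ℕ} (hLK : L < K) (ha : a ∈ levelPrimes K)
    (hb : b ∈ levelPrimes L) (hc : c ∈ levelPrimes K) (hd : d ∈ levelPrimes L)
    (hgood : ¬ IsColliding K a)
    (h : code K a + code L b = code K c + code L d) : a = c ∧ b = d := by
  obtain ⟨h1, h2⟩ := dvd_of_code_add_eq hLK.le (fun _ => not_modulus_dvd ha)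
    (fun _ => not_modulus_dvd hb) (fun _ => not_modulus_dvd hc) (fun _ => not_modulus_dvd hd) h
  have hac : a = c := by
    by_contra hne
    exact hgood ⟨L, hLK, c, hc, b, hb, d, hd, hne, h1, h2⟩
  subst hac
  rw [← mul_sub] at h1
  exact ⟨rfl, eq_of_prod_modulus_dvd_sub hb hd
    ((isCoprime_prod_modulus ha hLK.le).dvd_of_dvd_mul_left h1)⟩

theorem code_injOn (K : ℕ) : Set.InjOn (code K) (levelPrimes K) := fun a ha b hb h => by
  rcases eq_or_swap_of_code_add_eq_same_level ha ha hb hb (by rw [h]) with h | h <;> exact h.1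

/-! ### The Sidon set -/

/-- The codes of all primes, of all levels, that are not colliding. -/
def sidonSet : Set ℤ := {n | ∃ K, ∃ p ∈ levelPrimes K, ¬ IsColliding K p ∧ n = code K p}

theorem eq_or_swap_of_code_add_eq {K L K' L' a b c d : ℕ} (hL : L ≤ K) (hL' : L' ≤ K')
    (ha : a ∈ levelPrimes K) (hb : b ∈ levelPrimes L) (hc : c ∈ levelPrimes K')
    (hd : d ∈ levelPrimes L') (hgood : ¬ IsColliding K a)
    (h : code K a + code L b = code K' c + code L' d) :
    (code K a = code K' c ∧ code L b = code L' d) ∨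
      (code K a = code L' d ∧ code L b = code K' c) := by
  obtain ⟨rfl, rfl⟩ := levels_eq_of_code_add_eq hL hL' h
  rcases hL.eq_or_lt with rfl | hlt
  · rcases eq_or_swap_of_code_add_eq_same_level ha hb hc hd h with ⟨rfl, rfl⟩ | ⟨rfl, rfl⟩
    · exact Or.inl ⟨rfl, rfl⟩
    · exact Or.inr ⟨rfl, rfl⟩
  · obtain ⟨rfl, rfl⟩ := eq_of_code_add_eq_of_lt hlt ha hb hc hd hgood h
    exact Or.inl ⟨rfl, rfl⟩

theorem isSidonSet_sidonSet : IsSidonSet sidonSet := by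
  rintro _ ⟨K, a, ha, hga, rfl⟩ _ ⟨L, b, hb, hgb, rfl⟩ _ ⟨K', c, hc, -, rfl⟩ _ ⟨L', d, hd, -, rfl⟩ h
  norm_cast at h ⊢
  rcases le_total L K with hL | hL <;> rcases le_total L' K' with hL' | hL'
  · exact eq_or_swap_of_code_add_eq hL hL' ha hb hc hd hga h
  · have := eq_or_swap_of_code_add_eq hL hL' ha hb hd hc hga (by omega)
    omega
  · have := eq_or_swap_of_code_add_eq hL hL' hb ha hc hd hgb (by omega)
    omega
  · have := eq_or_swap_of_code_add_eq hL hL' hb ha hd hc hgb (by omega)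
    omega

theorem sidonSet_pos : ∀ n ∈ sidonSet, 0 < n := by
  rintro _ ⟨K, p, hp, -, rfl⟩
  have := two_pow_le_code (pos_of_mem_levelPrimes hp) p
  have : 0 < 2 ^ K ^ 2 := by positivity
  omega

/-! ### Counting colliding primes -/

/-- The product of the distinct prime factors is at least `2` to their number. -/
theorem card_primeFactors_le_of_le_two_pow {n k : ℕ} (h : n ≤ 2 ^ k) : n.primeFactors.card ≤ k := by
  rcases Nat.eq_zero_or_pos n with rfl | hn
  · simp
  refine (Nat.pow_le_pow_iff_right (a := 2) (by norm_num)).1 (le_trans ?_ h)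
  refine le_trans ?_ (Nat.le_of_dvd hn (Nat.prod_primeFactors_dvd n))
  exact Finset.pow_card_le_prod _ _ _ fun p hp => (Nat.prime_of_mem_primeFactors hp).two_le

theorem card_Icc_neg_two_pow_le (k : ℕ) :
    (Finset.Icc (-2 ^ k : ℤ) (2 ^ k)).card ≤ 3 * 2 ^ k := by
  rw [Int.card_Icc, Int.toNat_le]
  have : (1 : ℤ) ≤ 2 ^ k := one_le_pow₀ (by norm_num)
  push_cast
  linarith

/-- For a collision `p * s - r * t = u * Q`, `p - r = v * R` between level `K` and level `L`,
the prime `p` divides `u * Q - v * t * R`, which is nonzero and at most `2 ^ K ^ 2`. -/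
noncomputable def collisionFactors (K L : ℕ) (x : ℕ × ℤ × ℤ) : Finset ℕ :=
  let M := (x.2.1 * (∏ j ∈ Finset.range L, modulus j : ℕ) -
    x.2.2 * x.1 * (∏ j ∈ Finset.Ico L K, modulus j : ℕ)).natAbs
  if M ≤ 2 ^ K ^ 2 then M.primeFactors else ∅

theorem card_collisionFactors_le (K L : ℕ) (x : ℕ × ℤ × ℤ) :
    (collisionFactors K L x).card ≤ K ^ 2 := by
  rw [collisionFactors]
  split_ifs with h
  · exact card_primeFactors_le_of_le_two_pow h
  · simp

/-- The levels `L` that can collide with level `K`. -/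
noncomputable def collisionLevels (K : ℕ) : Finset ℕ :=
  (Finset.range K).filter fun L =>
    levelExp L ≠ 0 ∧ L ^ 2 ≤ levelExp K + levelExp L ∧ K ^ 2 ≤ levelExp K + L ^ 2

/-- The parameters `(t, u, v)` of a collision between level `K` and level `L`. -/
noncomputable def collisionParams (K L : ℕ) : Finset (ℕ × ℤ × ℤ) :=
  levelPrimes L ×ˢ
    Finset.Icc (-2 ^ (levelExp K + levelExp L - L ^ 2)) (2 ^ (levelExp K + levelExp L - L ^ 2)) ×ˢ
    Finset.Icc (-2 ^ (levelExp K + L ^ 2 - K ^ 2)) (2 ^ (levelExp K + L ^ 2 - K ^ 2))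

theorem card_levelPrimes_le (K : ℕ) : (levelPrimes K).card ≤ 2 ^ levelExp K := by
  refine (Finset.card_filter_le _ _).trans ?_
  simp

/-- In the product of the three ranges `L²` cancels, leaving the exponent `2 n_K + 2 n_L - K²`;
`levelExp_add_le` then saves a factor `2 ^ K`. Membership in `collisionLevels` keeps the natural
subtractions from truncating. -/
theorem card_collisionParams_le {K L : ℕ} (hL : L ∈ collisionLevels K) :
    (collisionParams K L).card * 2 ^ K ≤ 9 * 2 ^ levelExp K := by
  simp only [collisionLevels, Finset.mem_filter, Finset.mem_range] at hL
  obtain ⟨hLK, h0, h1, h2⟩ := hL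
  have h3 := levelExp_add_le h0 hLK.le h1
  rw [collisionParams, Finset.card_product, Finset.card_product]
  calc _ ≤ 2 ^ levelExp L * (3 * 2 ^ (levelExp K + levelExp L - L ^ 2) *
          (3 * 2 ^ (levelExp K + L ^ 2 - K ^ 2))) * 2 ^ K := by
        gcongr
        · exact card_levelPrimes_le L
        · exact card_Icc_neg_two_pow_le _
        · exact card_Icc_neg_two_pow_le _
    _ = 9 * 2 ^ (levelExp L + (levelExp K + levelExp L - L ^ 2) +
          (levelExp K + L ^ 2 - K ^ 2) + K) := by ring
    _ ≤ 9 * 2 ^ levelExp K := by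
        gcongr
        · norm_num
        · omega

/-- A nonzero multiple of `Q` is at least `Q` in absolute value. The conclusion `b ≤ a` is what
restricts the levels that can collide. -/
theorem abs_le_two_pow_sub {u Q : ℤ} {a b : ℕ} (hu : u ≠ 0) (hQ : 2 ^ b ≤ Q)
    (h : |u * Q| ≤ 2 ^ a) : b ≤ a ∧ |u| ≤ 2 ^ (a - b) := by
  have hb : (0 : ℤ) < 2 ^ b := by positivity
  rw [abs_mul, abs_of_pos (hb.trans_le hQ)] at h
  have h1 : |u| * 2 ^ b ≤ 2 ^ a := (mul_le_mul_of_nonneg_left hQ (abs_nonneg u)).trans h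
  have hba : b ≤ a := by
    have : (2 : ℤ) ^ b ≤ 2 ^ a :=
      (le_mul_of_one_le_left hb.le (Int.one_le_abs hu)).trans h1
    exact (pow_le_pow_iff_right₀ (by norm_num)).1 this
  refine ⟨hba, le_of_mul_le_mul_right (h1.trans_eq ?_) hb⟩
  rw [← pow_add, Nat.sub_add_cancel hba]

theorem abs_mul_sub_mul_le {a b c d m : ℕ} (h : a * b ≤ m) (h' : c * d ≤ m) :
    |(a * b - c * d : ℤ)| ≤ m := by
  zify at h h'
  have : (0 : ℤ) ≤ a * b := by positivity
  have : (0 : ℤ) ≤ c * d := by positivity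
  rw [abs_le]
  constructor <;> linarith

theorem exists_mem_collisionFactors {K p : ℕ} (hp : p ∈ levelPrimes K) (h : IsColliding K p) :
    ∃ L ∈ collisionLevels K, ∃ x ∈ collisionParams K L, p ∈ collisionFactors K L x := by
  obtain ⟨L, hLK, r, hr, s, hs, t, ht, hpr, ⟨u, hu⟩, ⟨v, hv⟩⟩ := h
  have hQ : ((2 ^ L ^ 2 : ℕ) : ℤ) ≤ (∏ j ∈ Finset.range L, modulus j : ℕ) := by
    exact_mod_cast two_pow_sq_le_prod_modulus L
  have hR : ((2 ^ K ^ 2 : ℕ) : ℤ) ≤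
      (2 ^ L ^ 2 * ∏ j ∈ Finset.Ico L K, modulus j : ℕ) := by
    exact_mod_cast two_pow_le_prod_Ico_modulus hLK.le
  -- With `s = t`, which is prime to the moduli below `L`, every `q_j` with `j < K` would divide `p
  -- - r`, forcing `p = r`.
  have hst : s ≠ t := by
    rintro rfl
    refine hpr (eq_of_prod_modulus_dvd_sub hp hr ?_)
    refine prod_modulus_dvd fun j hj => ?_
    rw [Finset.mem_range] at hj
    rcases lt_or_ge j L with hjL | hjL
    · have h1 : (modulus j : ℤ) ∣ ((p : ℤ) - r) * s := by
        rw [sub_mul, hu]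
        refine Dvd.dvd.mul_right ?_ _
        exact_mod_cast Finset.dvd_prod_of_mem modulus (Finset.mem_range.2 hjL)
      refine ((Nat.prime_iff_prime_int.1 (modulus_prime j)).dvd_or_dvd h1).resolve_right ?_
      exact_mod_cast not_modulus_dvd hs hjL
    · rw [hv]
      refine Dvd.dvd.mul_right ?_ _
      exact_mod_cast Finset.dvd_prod_of_mem modulus (Finset.mem_Ico.2 ⟨hjL, hj⟩)
  have hprod : ∀ {a b : ℕ}, a ∈ levelPrimes K → b ∈ levelPrimes L →
      a * b ≤ 2 ^ (levelExp K + levelExp L) := fun ha hb => by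
    rw [pow_add]
    exact Nat.mul_le_mul (le_of_mem_levelPrimes ha) (le_of_mem_levelPrimes hb)
  have hsum : levelExp K + levelExp L ≤ K ^ 2 := by
    have := two_mul_levelExp_le K
    have := levelExp_mono hLK.le
    omega
  have habs := abs_mul_sub_mul_le (hprod hp hs) (hprod hr ht)
  have habs' := abs_mul_sub_mul_le (hprod hp hs) (hprod hp ht)
  generalize hQdef : ((∏ j ∈ Finset.range L, modulus j : ℕ) : ℤ) = Q at *
  generalize hRdef : (∏ j ∈ Finset.Ico L K, modulus j : ℕ) = R at *
  -- If `u = 0`, then `ps = rt`, so `p` is `r` or the prime `t` of a lower level; both are excluded.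
  have hu0 : u ≠ 0 := by
    rintro rfl
    rw [mul_zero, sub_eq_zero] at hu
    norm_cast at hu
    rcases eq_or_swap_of_mul_eq (prime_of_mem_levelPrimes hp) (prime_of_mem_levelPrimes hr)
      (prime_of_mem_levelPrimes ht) hu with h | h
    · exact hpr h.1
    · exact ne_of_mem_levelPrimes hLK hp ht h.1
  have hv0 : v ≠ 0 := by
    rintro rfl
    rw [mul_zero, sub_eq_zero] at hv
    exact hpr (by exact_mod_cast hv)
  obtain ⟨h1, h2⟩ := abs_le_two_pow_sub (a := levelExp K + levelExp L) (b := L ^ 2) hu0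
    (by exact_mod_cast hQ) (by rw [mul_comm, ← hu]; exact_mod_cast habs)
  -- The relation `p - r = vR` is multiplied by `2 ^ L ^ 2` to use the bound `2 ^ K ^ 2 ≤ 2 ^ L ^ 2
  -- * R`.
  obtain ⟨h3, h4⟩ := abs_le_two_pow_sub (a := levelExp K + L ^ 2) (b := K ^ 2) hv0
    (Q := 2 ^ L ^ 2 * R) (by exact_mod_cast hR) (by
      rw [mul_left_comm, mul_comm v, ← hv, abs_mul, abs_of_pos (by positivity), mul_comm, pow_add]
      exact mul_le_mul_of_nonneg_right (abs_sub_lt_of_mem_levelPrimes hp hr).le (by positivity))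
  refine ⟨L, ?_, (t, u, v), ?_, ?_⟩
  · simp only [collisionLevels, Finset.mem_filter, Finset.mem_range]
    exact ⟨hLK, levelExp_ne_zero_of_mem hs, h1, h3⟩
  · simp only [collisionParams, Finset.mem_product, Finset.mem_Icc]
    exact ⟨ht, abs_le.1 h2, abs_le.1 h4⟩
  · have key : u * Q - v * t * R = p * s - p * t := by
      linear_combination -hu + (t : ℤ) * hv
    simp only [collisionFactors, hQdef, hRdef, key]
    rw [if_pos]
    · rw [Nat.mem_primeFactors]
      refine ⟨prime_of_mem_levelPrimes hp, ?_, ?_⟩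
      · rw [← Int.natCast_dvd, ← mul_sub]
        exact dvd_mul_right _ _
      · rw [Int.natAbs_ne_zero, ← mul_sub]
        refine mul_ne_zero ?_ (sub_ne_zero.2 (by exact_mod_cast hst))
        exact_mod_cast (prime_of_mem_levelPrimes hp).ne_zero
    · zify
      refine habs'.trans ?_
      exact_mod_cast Nat.pow_le_pow_right (by norm_num) hsum

-- Union bound over at most `K` levels `L`, their parameter triples, and at most `K²` prime factors
-- per triple.
open Classical in
theorem card_colliding_mul_le (K : ℕ) :
    ((levelPrimes K).filter (IsColliding K)).card * 2 ^ K ≤ 9 * K ^ 3 * 2 ^ levelExp K := by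
  have hsub : (levelPrimes K).filter (IsColliding K) ⊆ (collisionLevels K).biUnion fun L =>
      (collisionParams K L).biUnion (collisionFactors K L) := by
    intro p hp
    rw [Finset.mem_filter] at hp
    simpa only [Finset.mem_biUnion] using exists_mem_collisionFactors hp.1 hp.2
  calc _ ≤ (∑ L ∈ collisionLevels K, (collisionParams K L).card * K ^ 2) * 2 ^ K := by
        gcongr
        refine (Finset.card_le_card hsub).trans (Finset.card_biUnion_le.trans ?_)
        refine Finset.sum_le_sum fun L _ => ?_
        exact Finset.card_biUnion_le_card_mul _ _ _ fun x _ => card_collisionFactors_le K L x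
    _ ≤ ∑ L ∈ collisionLevels K, K ^ 2 * (9 * 2 ^ levelExp K) := by
        rw [Finset.sum_mul]
        refine Finset.sum_le_sum fun L hL => ?_
        rw [mul_right_comm, mul_comm]
        exact Nat.mul_le_mul_left _ (card_collisionParams_le hL)
    _ ≤ K * (K ^ 2 * (9 * 2 ^ levelExp K)) := by
        rw [Finset.sum_const, smul_eq_mul]
        refine Nat.mul_le_mul_right _ ((Finset.card_filter_le _ _).trans ?_)
        simp
    _ = _ := by ring

/-! ### Lower bound for the number of non-colliding primes -/

theorem two_pow_le_mul_primeCounting {n : ℕ} (hn : 3 ≤ n) :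
    2 ^ n ≤ 2 * n * Nat.primeCounting (2 ^ n) := by
  have h := Chebyshev.pi_ge (2 ^ n)
  have hl : 0 < Real.log 2 := Real.log_pos (by norm_num)
  have hn0 : (0 : ℝ) < n := by exact_mod_cast (by omega : 0 < n)
  push_cast at h
  rw [Real.log_pow, div_le_iff₀ (by positivity)] at h
  have h1 : Real.log (2 ^ n + 1) ≤ (n + 1) * Real.log 2 := by
    have h2 : Real.log (2 ^ n + 1) ≤ Real.log (2 ^ (n + 1)) := by
      refine Real.log_le_log (by positivity) ?_
      have : (1 : ℝ) ≤ 2 ^ n := one_le_pow₀ (by norm_num)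
      rw [pow_succ]
      linarith
    rwa [Real.log_pow, Nat.cast_succ] at h2
  have h3 : (2 : ℝ) ^ n - (n + 1) ≤ n * Nat.primeCounting (2 ^ n) := by
    refine le_of_mul_le_mul_right ?_ hl
    linarith
  -- This makes the error `n + 1` at most half of the main term; `n = 3` is the case of equality.
  have h4 : 2 * (n + 1) ≤ 2 ^ n := by
    induction n, hn using Nat.le_induction with
    | base => norm_num
    | succ k hk ih =>
      have h5 : 2 * (k + 1) ≤ 2 ^ k := by
        clear * - hk
        induction k, hk using Nat.le_induction with
        | base => norm_num
        | succ k hk ih => rw [pow_succ]; omega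
      rw [pow_succ]; omega
  have h5 : (2 * (n + 1) : ℝ) ≤ 2 ^ n := by exact_mod_cast h4
  have : (2 : ℝ) ^ n ≤ 2 * n * Nat.primeCounting (2 ^ n) := by linarith
  exact_mod_cast this

theorem primeCounting_le_card_add (a b : ℕ) :
    Nat.primeCounting b ≤ ((Finset.Ioc a b).filter Nat.Prime).card + a := by
  rw [Nat.primeCounting, Nat.primeCounting', Nat.count_eq_card_filter_range]
  have : (Finset.range (b + 1)).filter Nat.Prime ⊆
      (Finset.Ioc a b).filter Nat.Prime ∪ Finset.Ioc 0 a := by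
    intro p hp
    simp only [Finset.mem_filter, Finset.mem_range, Finset.mem_union, Finset.mem_Ioc] at hp ⊢
    have := hp.2.pos
    by_cases h : a < p
    · exact Or.inl ⟨⟨h, by omega⟩, hp.2⟩
    · exact Or.inr ⟨this, by omega⟩
  refine (Finset.card_le_card this).trans ((Finset.card_union_le _ _).trans ?_)
  simp

theorem levelExp_pred_add_le {K : ℕ} (hK : 8 ≤ K) : levelExp (K - 1) + K / 2 ≤ levelExp K := by
  refine Nat.le_floor ?_
  obtain ⟨k, rfl⟩ : ∃ k, K = k + 1 := ⟨K - 1, by omega⟩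
  have hk : (7 : ℝ) ≤ k := by exact_mod_cast (by omega : 7 ≤ k)
  obtain ⟨c1, -⟩ := sqrt_two_sub_one_mem
  have h1 : (((k + 1) / 2 : ℕ) : ℝ) ≤ (k + 1) / 2 := by exact_mod_cast Nat.cast_div_le (α := ℝ)
  by_cases h0 : levelExp k = 0
  · rw [Nat.add_sub_cancel, h0]
    push_cast
    nlinarith
  · have h2 := levelExp_le h0
    rw [Nat.add_sub_cancel]
    push_cast
    nlinarith

theorem two_mul_add_two_le_levelExp {K : ℕ} (hK : 12 ≤ K) : 2 * K + 2 ≤ levelExp K := by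
  refine Nat.le_floor ?_
  have hk : (12 : ℝ) ≤ K := by exact_mod_cast hK
  obtain ⟨c1, -⟩ := sqrt_two_sub_one_mem
  push_cast
  nlinarith

theorem eventually_mul_pow_le_two_pow (C k : ℕ) : ∀ᶠ n : ℕ in atTop, C * n ^ k ≤ 2 ^ n := by
  have h := (isLittleO_pow_const_const_pow_of_one_lt (R := ℝ) k (r := 2) (by norm_num)).bound
    (c := 1 / (C + 1)) (by positivity)
  filter_upwards [h] with n hn
  rw [Real.norm_of_nonneg (by positivity), Real.norm_of_nonneg (by positivity), one_div_mul_eq_div,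
    le_div_iff₀ (by positivity)] at hn
  have h0 : (0 : ℝ) ≤ (n : ℝ) ^ k := by positivity
  have : (C : ℝ) * n ^ k ≤ 2 ^ n := by linarith
  exact_mod_cast this

/-- Passing from `K - 1` to `K` multiplies the range by at least `2 ^ (K / 2)`, so removing the
primes of lower levels costs little compared with Chebyshev's bound. -/
theorem eventually_two_pow_levelExp_le_card_levelPrimes :
    ∀ᶠ K in atTop, 2 ^ levelExp K ≤ 4 * K ^ 2 * (levelPrimes K).card := by
  have h1 := (Nat.tendsto_div_const_atTop (n := 2) (by norm_num)).eventually
    (eventually_mul_pow_le_two_pow 36 2)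
  filter_upwards [h1, eventually_ge_atTop 13] with K hK hK13
  have hpred := two_mul_add_two_le_levelExp (K := K - 1) (by omega)
  have hstep := levelExp_pred_add_le (K := K) (by omega)
  have h2 := two_pow_le_mul_primeCounting (n := levelExp K) (by omega)
  have h3 := primeCounting_le_card_add (2 ^ levelExp (K - 1)) (2 ^ levelExp K)
  -- Here `hpred` reads `2 * K ≤ levelExp (K - 1)`, so the cutoff `2 ^ (2 * K)` is inactive.
  have h4 : levelPrimes K =
      (Finset.Ioc (2 ^ levelExp (K - 1)) (2 ^ levelExp K)).filter Nat.Prime := by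
    rw [levelPrimes, max_eq_left (Nat.pow_le_pow_right (by norm_num) (by omega))]
  rw [← h4] at h3
  have h5 : 2 * levelExp K ≤ K ^ 2 := two_mul_levelExp_le K
  have h6 : 2 * K ^ 2 ≤ 2 ^ (K / 2) := by
    refine le_trans ?_ hK
    have : K ≤ 3 * (K / 2) := by omega
    nlinarith
  have h7 : 2 ^ levelExp (K - 1) * (2 * K ^ 2) ≤ 2 ^ levelExp K :=
    (Nat.mul_le_mul_left _ h6).trans
      ((pow_add 2 _ _).symm.trans_le (Nat.pow_le_pow_right (by norm_num) hstep))
  have h8 : 2 ^ levelExp K ≤ K ^ 2 * ((levelPrimes K).card + 2 ^ levelExp (K - 1)) :=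
    h2.trans (Nat.mul_le_mul h5 h3)
  nlinarith

open Classical in
theorem eventually_two_pow_levelExp_le :
    ∀ᶠ K in atTop, 2 ^ levelExp K ≤
      2 ^ K * ((levelPrimes K).filter fun p => ¬ IsColliding K p).card := by
  -- The constant is `40 = 36 + 4`: `4K² · 9K³` bounds the colliding primes, and `4K⁵` leaves room
  -- for the claim multiplied by `4K²`.
  filter_upwards [eventually_two_pow_levelExp_le_card_levelPrimes,
    eventually_mul_pow_le_two_pow 40 5, eventually_ge_atTop 1] with K h1 h2 hK
  have h3 := card_colliding_mul_le K
  rw [← Finset.card_filter_add_card_filter_not (s := levelPrimes K) (IsColliding K)] at h1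
  generalize ((levelPrimes K).filter (IsColliding K)).card = B at *
  generalize ((levelPrimes K).filter fun p => ¬ IsColliding K p).card = G at *
  generalize 2 ^ levelExp K = N at *
  generalize 2 ^ K = M at *
  have h4 : 4 * K ^ 2 * (B * M) ≤ 4 * K ^ 2 * (9 * K ^ 3 * N) := Nat.mul_le_mul_left _ h3
  have h5 : N * M ≤ 4 * K ^ 2 * (B + G) * M := Nat.mul_le_mul_right _ h1
  have h6 : N * (40 * K ^ 5) ≤ N * M := Nat.mul_le_mul_left _ h2
  have h7 : 4 * K ^ 2 * N ≤ 4 * K ^ 5 * N :=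
    Nat.mul_le_mul_right _ (Nat.mul_le_mul_left _ (Nat.pow_le_pow_right hK (by norm_num)))
  refine le_of_mul_le_mul_left (a := 4 * K ^ 2) ?_ (by positivity)
  nlinarith

/-! ### The counting function of the Sidon set -/

theorem sidonSet_infinite : sidonSet.Infinite := by
  classical
  refine Set.infinite_of_forall_exists_gt fun a => ?_
  obtain ⟨K, hK, hKa⟩ :=
    (eventually_two_pow_levelExp_le.and (eventually_ge_atTop a.toNat)).exists
  have hcard : 0 < ((levelPrimes K).filter fun p => ¬ IsColliding K p).card := by
    refine Nat.pos_of_ne_zero fun h0 => ?_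
    rw [h0, mul_zero] at hK
    exact absurd hK (not_le.2 (by positivity))
  obtain ⟨p, hp⟩ := Finset.card_pos.1 hcard
  rw [Finset.mem_filter] at hp
  refine ⟨code K p, ⟨K, p, hp.1, hp.2, rfl⟩, ?_⟩
  have hpos := pos_of_mem_levelPrimes hp.1
  have h1 := two_pow_le_code hpos p
  have h2 : K ^ 2 < 2 ^ K ^ 2 := Nat.lt_two_pow_self
  have h3 : K ≤ K ^ 2 := Nat.le_self_pow (by norm_num) K
  omega

theorem finite_inter_Icc (S : Set ℤ) (x : ℝ) : {n : ℤ | n ∈ S ∧ 1 ≤ n ∧ (n : ℝ) ≤ x}.Finite :=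
  (Set.finite_Icc 1 ⌊x⌋).subset fun _ h => ⟨h.2.1, Int.le_floor.2 h.2.2⟩

/-- Codes of level `K` are at least `2 ^ K ^ 2`, so only levels up to `m` contribute, each with at
most `2 ^ levelExp m` elements. -/
theorem countingFunction_sidonSet_le {x : ℝ} {m : ℕ} (hx : x < 2 ^ (m + 1) ^ 2) :
    countingFunction sidonSet x ≤ (m + 1) * 2 ^ levelExp m := by
  classical
  have hsub : {n : ℤ | n ∈ sidonSet ∧ 1 ≤ n ∧ (n : ℝ) ≤ x} ⊆
      ((Finset.range (m + 1)).biUnion fun K =>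
        (levelPrimes K).image fun p => (code K p : ℤ) : Finset ℤ) := by
    rintro _ ⟨⟨K, p, hp, -, rfl⟩, -, hle⟩
    simp only [Finset.coe_biUnion, Finset.mem_coe, Finset.mem_range, Set.mem_iUnion,
      Finset.mem_image]
    refine ⟨K, ?_, p, hp, rfl⟩
    have h1 := two_pow_le_code (pos_of_mem_levelPrimes hp) p
    have h2 : code K p < 2 ^ (m + 1) ^ 2 := by
      have := hle.trans_lt hx
      exact_mod_cast this
    have h3 := (Nat.pow_lt_pow_iff_right (by norm_num)).1 (h1.trans_lt h2)
    exact lt_of_pow_lt_pow_left₀ 2 (Nat.zero_le _) h3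
  refine (Set.ncard_le_ncard hsub (Finset.finite_toSet _)).trans ?_
  rw [Set.ncard_coe_finset]
  refine (Finset.card_biUnion_le_card_mul _ _ (2 ^ levelExp m) fun K hK => ?_).trans (by simp)
  refine Finset.card_image_le.trans ((card_levelPrimes_le K).trans ?_)
  rw [Finset.mem_range] at hK
  exact Nat.pow_le_pow_right (by norm_num) (levelExp_mono (by omega))

open Classical in
theorem card_le_countingFunction_sidonSet {x : ℝ} {K : ℕ} (hx : 2 ^ (K + 2) ^ 2 ≤ x) :
    ((levelPrimes K).filter fun p => ¬ IsColliding K p).card ≤ countingFunction sidonSet x := by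
  rw [← Finset.card_image_of_injOn (f := fun p => (code K p : ℤ)), ← Set.ncard_coe_finset]
  · refine Set.ncard_le_ncard ?_ (finite_inter_Icc _ _)
    intro n hn
    simp only [Finset.coe_image, Set.mem_image, Finset.mem_coe, Finset.mem_filter] at hn
    obtain ⟨p, ⟨hp, hgood⟩, rfl⟩ := hn
    have hmem : (code K p : ℤ) ∈ sidonSet := ⟨K, p, hp, hgood, rfl⟩
    refine ⟨hmem, sidonSet_pos _ hmem, le_trans ?_ hx⟩
    exact_mod_cast (code_lt_two_pow K p).le
  · intro a ha b hb hab
    rw [Finset.mem_coe, Finset.mem_filter] at ha hb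
    exact code_injOn K ha.1 hb.1 (Nat.cast_injective hab)

theorem eventually_countingFunction_le : ∀ᶠ x : ℝ in atTop,
    (countingFunction sidonSet x : ℝ) ≤ 2 ^ ((√2 - 1) * Real.logb 2 x) := by
  filter_upwards [eventually_ge_atTop ((2 : ℝ) ^ (12 ^ 2))] with x hx
  have hx0 : 0 < x := lt_of_lt_of_le (by positivity) hx
  have ht : ((12 : ℝ)) ^ 2 ≤ Real.logb 2 x := by
    rw [Real.le_logb_iff_rpow_le (by norm_num) hx0]
    exact_mod_cast hx
  have hs12 : 12 ≤ √(Real.logb 2 x) := Real.le_sqrt_of_sq_le ht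
  have hst : √(Real.logb 2 x) ^ 2 = Real.logb 2 x := Real.sq_sqrt (by linarith)
  set s := √(Real.logb 2 x)
  have hm12 : 12 ≤ ⌊s⌋₊ := Nat.le_floor (by exact_mod_cast hs12)
  have hms : (⌊s⌋₊ : ℝ) ≤ s := Nat.floor_le (by linarith)
  have hsm := Nat.lt_floor_add_one s
  set m := ⌊s⌋₊
  have hxm : x < 2 ^ (m + 1) ^ 2 := by
    have : Real.logb 2 x < ((m + 1) ^ 2 : ℕ) := by
      rw [← hst]; push_cast; nlinarith
    rwa [Real.logb_lt_iff_lt_rpow (by norm_num) hx0, Real.rpow_natCast] at this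
  have hn := levelExp_le (K := m) (by have := two_mul_add_two_le_levelExp hm12; omega)
  -- The number of levels `m + 1` is bounded by `2 ^ m`, which the `- m` inside `levelExp m`
  -- cancels.
  have h1 : (countingFunction sidonSet x : ℝ) ≤ 2 ^ (m + levelExp m) := by
    have h2 : m + 1 ≤ 2 ^ m := Nat.lt_two_pow_self
    have := (countingFunction_sidonSet_le hxm).trans (Nat.mul_le_mul_right _ h2)
    rw [← pow_add] at this
    exact_mod_cast this
  refine h1.trans ?_
  rw [← Real.rpow_natCast]
  refine Real.rpow_le_rpow_of_exponent_le (by norm_num) ?_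
  have hc := sqrt_two_sub_one_mem.1
  have : (√2 - 1) * (m : ℝ) ^ 2 ≤ (√2 - 1) * Real.logb 2 x := by
    rw [← hst]; gcongr
  push_cast
  linarith

theorem eventually_le_countingFunction : ∀ᶠ x : ℝ in atTop,
    2 ^ ((√2 - 1) * Real.logb 2 x - 6 * √(Real.logb 2 x)) ≤
      (countingFunction sidonSet x : ℝ) := by
  have htend : Tendsto (fun x : ℝ => ⌊√(Real.logb 2 x)⌋₊ - 2) atTop atTop :=
    (tendsto_sub_atTop_nat 2).comp <| tendsto_nat_floor_atTop.comp <|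
      Real.tendsto_sqrt_atTop.comp <| Real.tendsto_logb_atTop (by norm_num)
  filter_upwards [htend.eventually eventually_two_pow_levelExp_le,
    eventually_ge_atTop ((2 : ℝ) ^ (12 ^ 2))] with x hK hx
  have hx0 : 0 < x := lt_of_lt_of_le (by positivity) hx
  have ht : ((12 : ℝ)) ^ 2 ≤ Real.logb 2 x := by
    rw [Real.le_logb_iff_rpow_le (by norm_num) hx0]
    exact_mod_cast hx
  have hs12 : 12 ≤ √(Real.logb 2 x) := Real.le_sqrt_of_sq_le ht
  have hst : √(Real.logb 2 x) ^ 2 = Real.logb 2 x := Real.sq_sqrt (by linarith)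
  set s := √(Real.logb 2 x)
  have hm12 : 12 ≤ ⌊s⌋₊ := Nat.le_floor (by exact_mod_cast hs12)
  have hms : (⌊s⌋₊ : ℝ) ≤ s := Nat.floor_le (by linarith)
  have hsm := Nat.lt_floor_add_one s
  -- Codes of level `K` stay below `2 ^ (K + 2) ^ 2`, so the largest level sure to fit below `x` is
  -- taken as `⌊s⌋₊ - 2`.
  obtain ⟨K, hKm⟩ : ∃ K, ⌊s⌋₊ = K + 2 := ⟨⌊s⌋₊ - 2, by omega⟩
  rw [hKm] at hms hsm hK
  rw [Nat.add_sub_cancel] at hK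
  push_cast at hms hsm
  have hxK : (2 : ℝ) ^ (K + 2) ^ 2 ≤ x := by
    have : (((K + 2) ^ 2 : ℕ) : ℝ) ≤ Real.logb 2 x := by
      rw [← hst]; push_cast; gcongr
    rwa [Real.le_logb_iff_rpow_le (by norm_num) hx0, Real.rpow_natCast] at this
  have h1 : (2 : ℝ) ^ levelExp K ≤ 2 ^ K * countingFunction sidonSet x := by
    exact_mod_cast hK.trans (Nat.mul_le_mul_left _ (card_le_countingFunction_sidonSet hxK))
  have h2 := lt_levelExp_add_one K
  have hc := sqrt_two_sub_one_mem.1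
  -- The loss is `6c s` from `(s - 3)²`, with `6c < 2.5`, and `2K ≤ 2s` from the two terms `- K`;
  -- hence `6 s` suffices.
  have h3 : (√2 - 1) * Real.logb 2 x - 6 * s ≤ levelExp K - K := by
    have h4 : (√2 - 1) * (s - 3) ^ 2 ≤ (√2 - 1) * (K : ℝ) ^ 2 := by
      gcongr <;> linarith
    have h5 := mul_le_mul_of_nonneg_right sqrt_two_sub_one_mem.2.le (show 0 ≤ s by linarith)
    rw [← hst]
    linarith
  refine (Real.rpow_le_rpow_of_exponent_le (by norm_num) h3).trans ?_
  rw [Real.rpow_sub (by norm_num), Real.rpow_natCast, Real.rpow_natCast]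
  exact div_le_of_le_mul₀ (by positivity) (by positivity) (by linarith)

/-- Solving for the exponent gives `ε = log f / log x - c`, which the two bounds squeeze between `-C
/ √(log₂ x)` and `0`. -/
theorem exists_tendsto_zero_of_rpow_bounds {f : ℝ → ℝ} {c C : ℝ}
    (hle : ∀ᶠ x in atTop, f x ≤ 2 ^ (c * Real.logb 2 x))
    (hge : ∀ᶠ x in atTop, 2 ^ (c * Real.logb 2 x - C * √(Real.logb 2 x)) ≤ f x) :
    ∃ ε : ℝ → ℝ, Tendsto ε atTop (𝓝 0) ∧ ∀ᶠ x in atTop, f x = x ^ (c + ε x) := by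
  have hlog : Tendsto (Real.logb 2) atTop atTop := Real.tendsto_logb_atTop (by norm_num)
  refine ⟨fun x => Real.logb 2 (f x) / Real.logb 2 x - c, ?_, ?_⟩
  · have hlim : Tendsto (fun x => -(C / √(Real.logb 2 x))) atTop (𝓝 0) := by
      rw [← neg_zero]
      exact ((Real.tendsto_sqrt_atTop.comp hlog).const_div_atTop C).neg
    refine tendsto_of_tendsto_of_tendsto_of_le_of_le' hlim tendsto_const_nhds ?_ ?_
    · filter_upwards [hge, hlog.eventually_gt_atTop 0] with x hx ht
      have hf : 0 < f x := lt_of_lt_of_le (by positivity) hx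
      have h1 := (Real.le_logb_iff_rpow_le (by norm_num) hf).2 hx
      have hs : √(Real.logb 2 x) ≠ 0 := (Real.sqrt_pos.2 ht).ne'
      have h2 : C / √(Real.logb 2 x) = C * √(Real.logb 2 x) / Real.logb 2 x := by
        rw [div_eq_div_iff hs ht.ne', mul_assoc, Real.mul_self_sqrt ht.le]
      rw [h2, neg_le_sub_iff_le_add, ← add_div, le_div_iff₀ ht]
      linarith
    · filter_upwards [hge, hle, hlog.eventually_gt_atTop 0] with x hx hx' ht
      have hf : 0 < f x := lt_of_lt_of_le (by positivity) hx
      have h1 := (Real.logb_le_iff_le_rpow (by norm_num) hf).2 hx'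
      rw [sub_nonpos, div_le_iff₀ ht]
      exact h1
  · filter_upwards [hge, hlog.eventually_gt_atTop 0, eventually_gt_atTop 0] with x hx ht hx0
    have hf : 0 < f x := lt_of_lt_of_le (by positivity) hx
    rw [add_sub_cancel]
    nth_rw 2 [← Real.rpow_logb (b := 2) (by norm_num) (by norm_num) hx0]
    rw [← Real.rpow_mul (by norm_num), mul_div_cancel₀ _ ht.ne',
      Real.rpow_logb (by norm_num) (by norm_num) hf]

theorem theorem4p5 :
    ∃ S : Set ℤ, S.Infinite ∧ (∀ n ∈ S, 0 < n) ∧ IsSidonSet S ∧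
      ∃ ε : ℝ → ℝ, Tendsto ε atTop (𝓝 0) ∧
        ∀ᶠ x : ℝ in atTop,
          (countingFunction S x : ℝ) = x ^ (Real.sqrt 2 - 1 + ε x) :=
  ⟨sidonSet, sidonSet_infinite, sidonSet_pos, isSidonSet_sidonSet,
    exists_tendsto_zero_of_rpow_bounds eventually_countingFunction_le
      eventually_le_countingFunction⟩
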